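/- Let $n\ge 1$. For a bounded measurable function $m$ on $\mathbb R^n\times\mathbb R^n$ and Schwartz functions $f,g$ on $\mathbb R^n$ put $$M_m(f,g)(x)=\int_{\mathbb R^n}\int_{\mathbb R^n}\hat f(\xi)\,\hat g(\eta)\,m(\xi,\eta)\,e^{2\pi i x\cdot(\xi+\eta)}\,d\xi\,d\eta ,\qquad \hat f(\xi)=\int_{\mathbb R^n} f(x)e^{-2\pi i x\cdot \xi}\,dx .$$ For exponents with $p,q<\infty$ and $\frac1p+\frac1q=\frac1r$ write $m\in\mathcal M_{p,q,r}(\mathbb R^n)$ if there is a constant $C$ such that $\|M_m(f,g)\|_{L^r}\le C\|f\|_{L^p}\|g\|_{L^q}$ for all Schwartz functions $f,g$, that is, if $M_m$ extends to a bounded operator $L^p\times L^q\to L^r$. Similarly, a bounded measurable $m$ on $\mathbb R^n$ is an $L^p$ multiplier, $m\in M_p(\mathbb R^n)$ ($1\le p<\infty$), if $\|S_mf\|_{L^p}\le C\|f\|_{L^p}$ for all Schwartz $f$, where $S_mf(x)=\int_{\mathbb R^n} m(\xi)\hat f(\xi)e^{2\pi i x\cdot\xi}\,d\xi$. The local $L^2$-range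 is the set of triples $(p,q,r)$ with $2\le p,q,r'\le\infty$ and $\frac1p+\frac1q=\frac1r$, where $\frac1r+\frac1{r'}=1$; the local $L^2$-triangle is the region of the corresponding points $(\frac1p,\frac1q)$ in the plane. Then: 1. If $\frac1p+\frac1q=\frac1r$ and $(\frac1p,\frac1q)$ is an interior point of the local $L^2$-triangle, then $e^{i(|\xi|^2+|\eta|^2)}\notin\mathcal M_{p,q,r}(\mathbb R^n)$. 2. For $2<p<4$: if $e^{i(|\xi|^2+|\eta|^2)}$ belonged to $\mathcal M_{p,p,p/2}(\mathbb R^n)$, then $e^{i|\xi|^2}$ would belong to $M_p(\mathbb R^n)$; but $e^{i|\xi|^2}\notin M_p(\mathbb R^n)$. -/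

import Mathlib

open MeasureTheory
open scoped ENNReal NNReal FourierTransform SchwartzMap

noncomputable section

/-- The local `L²` range: the triples `(p, q, r)` with `2 ≤ p, q, r' ≤ ∞` and
`1/p + 1/q = 1/r`, where `r'` is the exponent conjugate to `r`. -/
def localL2Range : Set (ℝ≥0∞ × ℝ≥0∞ × ℝ≥0∞) :=
  {t | 2 ≤ t.1 ∧ 2 ≤ t.2.1 ∧ (∃ r' : ℝ≥0∞, t.2.2.HolderConjugate r' ∧ 2 ≤ r') ∧
    t.1⁻¹ + t.2.1⁻¹ = t.2.2⁻¹}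

/-- The local `L²` triangle: the closed plane region of all points `(1/p, 1/q)` with `(p, q, r)` in
the local `L²` range (the third coordinate `1/r = 1/p + 1/q` is determined by the first two). -/
def localL2Triangle : Set (ℝ × ℝ) :=
  {z | ∃ p q r : ℝ≥0∞, (p, q, r) ∈ localL2Range ∧ z = (p⁻¹.toReal, q⁻¹.toReal)}

/-- The linear Fourier multiplier operator with symbol `m`, on Schwartz functions:
`S_m f (x) = ∫ m(ξ) f̂(ξ) e^{2πi x·ξ} dξ`. -/
def linearMultiplierOp {n : ℕ} (m : EuclideanSpace ℝ (Fin n) → ℂ)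
    (f : 𝓢(EuclideanSpace ℝ (Fin n), ℂ)) (x : EuclideanSpace ℝ (Fin n)) : ℂ :=
  ∫ ξ, 𝓕 (f : EuclideanSpace ℝ (Fin n) → ℂ) ξ * m ξ *
    Complex.exp (2 * Real.pi * Complex.I * (inner ℝ x ξ : ℝ))

/-- `m` (bounded and measurable) is an `L^p` Fourier multiplier, `1 ≤ p < ∞`:
`S_m` extends from Schwartz functions to a bounded operator on `L^p`. -/
def IsLpMultiplier {n : ℕ} (m : EuclideanSpace ℝ (Fin n) → ℂ) (p : ℝ≥0∞) : Prop :=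
  ∃ C : ℝ≥0, ∀ f : 𝓢(EuclideanSpace ℝ (Fin n), ℂ),
    eLpNorm (linearMultiplierOp m f) p volume ≤ C * eLpNorm f p volume

/-- The bilinear Fourier multiplier operator with symbol `m`, on Schwartz functions:
`M_m (f, g) (x) = ∫ ∫ f̂(ξ) ĝ(η) m(ξ, η) e^{2πi x·(ξ + η)} dξ dη`. -/
def bilinearMultiplierOp {n : ℕ}
    (m : EuclideanSpace ℝ (Fin n) → EuclideanSpace ℝ (Fin n) → ℂ)
    (f g : 𝓢(EuclideanSpace ℝ (Fin n), ℂ)) (x : EuclideanSpace ℝ (Fin n)) : ℂ :=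
  ∫ ξ, ∫ η, 𝓕 (f : EuclideanSpace ℝ (Fin n) → ℂ) ξ *
    𝓕 (g : EuclideanSpace ℝ (Fin n) → ℂ) η * m ξ η *
    Complex.exp (2 * Real.pi * Complex.I * (inner ℝ x (ξ + η) : ℝ))

/-- `m` (bounded and measurable) is a bilinear multiplier symbol for `(p, q, r)`, `p, q < ∞`:
`M_m` extends from Schwartz functions to a bounded operator `L^p × L^q → L^r`. -/
def IsBilinearMultiplier {n : ℕ}
    (m : EuclideanSpace ℝ (Fin n) → EuclideanSpace ℝ (Fin n) → ℂ) (p q r : ℝ≥0∞) : Prop :=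
  ∃ C : ℝ≥0, ∀ f g : 𝓢(EuclideanSpace ℝ (Fin n), ℂ),
    eLpNorm (bilinearMultiplierOp m f g) r volume ≤
      C * eLpNorm f p volume * eLpNorm g q volume

/-- The symbol `e^{i|ξ|²}` on `ℝⁿ`. -/
def quadSymbol (n : ℕ) (ξ : EuclideanSpace ℝ (Fin n)) : ℂ :=
  Complex.exp (Complex.I * (‖ξ‖ ^ 2 : ℝ))

/-- The symbol `e^{i(|ξ|² + |η|²)}` on `ℝⁿ × ℝⁿ`. -/
def quadSumSymbol (n : ℕ) (ξ η : EuclideanSpace ℝ (Fin n)) : ℂ :=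
  Complex.exp (Complex.I * (‖ξ‖ ^ 2 + ‖η‖ ^ 2 : ℝ))

end

/-! The symbol is a tensor product, so the bilinear operator is the pointwise product `S f * S g`,
with `S` the multiplier operator of `e^{i|ξ|²}`. Taking `g = f` reduces both parts to bounds on `‖S
f‖²` in `L^{2R}`. `S` focuses chirps: for `f = e^{-b|x|²}`, `b = π²/(s+i)`, the transform is a
multiple of `e^{-(s+i)|ξ|²}`; the symbol cancels the phase, and `S f` is a multiple of `s^{-n/2}
e^{-π²|x|²/s}`. As `s → 0`, `‖f‖_P` is of order `s^{-n/(2P)}` and `‖S f‖_{2R}` of order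
`s^{-n/2+n/(4R)}`. If `1/P + 1/Q = 1/R`, then `‖S f‖²_{2R} / (‖f‖_P ‖f‖_Q)` grows like
`s^{-n(1-1/R)}`, unbounded for `R > 1` (`not_exists_eLpNorm_linearMultiplierOp_sq_le`). -/

/-! ### Complex Gaussians are Schwartz functions -/

theorem one_add_pow_mul_exp_neg_mul_sq_le {c : ℝ} (hc : 0 < c) (N : ℕ) {t : ℝ} (ht : 0 ≤ t) :
    (1 + t) ^ N * Real.exp (-(c * t ^ 2)) ≤ N.factorial * Real.exp (1 + 1 / (4 * c)) := by
  have h1 : (1 + t) ^ N ≤ N.factorial * Real.exp (1 + t) := by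
    have := Real.pow_div_factorial_le_exp (x := 1 + t) (by linarith) N
    rwa [div_le_iff₀ (by positivity), mul_comm] at this
  have h2 : 1 + t + -(c * t ^ 2) ≤ 1 + 1 / (4 * c) := by
    have : 1 / (4 * c) - t + c * t ^ 2 = c * (t - 1 / (2 * c)) ^ 2 := by
      field_simp
      ring
    have : 0 ≤ c * (t - 1 / (2 * c)) ^ 2 := by positivity
    linarith
  calc (1 + t) ^ N * Real.exp (-(c * t ^ 2))
      ≤ N.factorial * Real.exp (1 + t) * Real.exp (-(c * t ^ 2)) := by gcongr
    _ = N.factorial * Real.exp (1 + t + -(c * t ^ 2)) := by rw [mul_assoc, ← Real.exp_add]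
    _ ≤ _ := by gcongr

theorem iteratedDeriv_cexp_mul_ofReal (b : ℂ) (i : ℕ) :
    iteratedDeriv i (fun t : ℝ => Complex.exp (b * t)) =
      fun t : ℝ => b ^ i * Complex.exp (b * t) := by
  induction i with
  | zero => simp
  | succ i ih =>
    rw [iteratedDeriv_succ, ih]
    ext t
    have h : HasDerivAt (fun t : ℝ => b * (t : ℂ)) (b * 1) t :=
      (Complex.ofRealCLM.hasDerivAt (x := t)).const_mul b
    rw [(h.cexp.const_mul (b ^ i)).deriv]
    ring

/-- The Gaussian `x ↦ e^{-b|x|²}`, `0 < Re b`, as a Schwartz function. -/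
noncomputable def gaussianSchwartz {V : Type*} [NormedAddCommGroup V] [InnerProductSpace ℝ V] (b : ℂ)
    (hb : 0 < b.re) : 𝓢(V, ℂ) where
  toFun x := Complex.exp (-b * (‖x‖ ^ 2 : ℝ))
  smooth' := by
    have h : ContDiff ℝ (⊤ : ℕ∞) fun x : V => ‖x‖ ^ 2 := contDiff_norm_sq ℝ
    have h2 : ContDiff ℝ (⊤ : ℕ∞) fun x : V => ((‖x‖ ^ 2 : ℝ) : ℂ) :=
      Complex.ofRealCLM.contDiff.comp h
    exact (contDiff_const.mul h2).cexp
  decay' k n := by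
    obtain ⟨l, C, hC, h⟩ :=
      (Function.hasTemperateGrowth_norm_sq (H := V)).norm_iteratedFDeriv_le_uniform n
    set g : ℝ → ℂ := fun t => Complex.exp (-b * t) with hg
    have hgs : ContDiff ℝ n g := (contDiff_const.mul Complex.ofRealCLM.contDiff).cexp
    refine ⟨n.factorial * (1 + ‖b‖) ^ n * (1 + C) ^ n *
      ((k + l * n).factorial * Real.exp (1 + 1 / (4 * b.re))), fun x => ?_⟩
    have hexp (t : ℝ) : ‖Complex.exp (-b * t)‖ = Real.exp (-(b.re * t)) := by
      simp [Complex.norm_exp]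
    have key := norm_iteratedFDeriv_comp_le hgs (contDiff_norm_sq ℝ) le_rfl x
      (C := (1 + ‖b‖) ^ n * Real.exp (-(b.re * ‖x‖ ^ 2))) (D := (1 + C) * (1 + ‖x‖) ^ l)
      (fun i hi => by
        rw [norm_iteratedFDeriv_eq_norm_iteratedDeriv, hg, iteratedDeriv_cexp_mul_ofReal,
          norm_mul, hexp, norm_pow, norm_neg]
        gcongr
        calc ‖b‖ ^ i ≤ (1 + ‖b‖) ^ i := by gcongr; linarith
          _ ≤ (1 + ‖b‖) ^ n := pow_le_pow_right₀ (by linarith [norm_nonneg b]) hi)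
      (fun i h1 hi => by
        refine (h i hi x).trans ?_
        -- The composition bound wants `D ^ i` for the `i`-th derivative; replacing `C` by `1 + C`
        -- makes `D ≥ 1`, so `D ≤ D ^ i` for `i ≥ 1`.
        have h3 : 1 ≤ (1 + C) * (1 + ‖x‖) ^ l :=
          one_le_mul_of_one_le_of_one_le (by linarith)
            (one_le_pow₀ (by linarith [norm_nonneg x]))
        calc C * (1 + ‖x‖) ^ l ≤ (1 + C) * (1 + ‖x‖) ^ l := by gcongr; linarith
          _ ≤ _ := le_self_pow₀ h3 (by omega))
    calc ‖x‖ ^ k * ‖iteratedFDeriv ℝ n (g ∘ fun x : V => ‖x‖ ^ 2) x‖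
        ≤ (1 + ‖x‖) ^ k * (n.factorial * ((1 + ‖b‖) ^ n * Real.exp (-(b.re * ‖x‖ ^ 2))) *
          ((1 + C) * (1 + ‖x‖) ^ l) ^ n) := by
          gcongr
          linarith
      _ = n.factorial * (1 + ‖b‖) ^ n * (1 + C) ^ n *
          ((1 + ‖x‖) ^ (k + l * n) * Real.exp (-(b.re * ‖x‖ ^ 2))) := by
          rw [pow_add, pow_mul, mul_pow]
          ring
      _ ≤ _ := by
          exact mul_le_mul_of_nonneg_left
            (one_add_pow_mul_exp_neg_mul_sq_le hb _ (norm_nonneg x)) (by positivity)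

theorem gaussianSchwartz_apply {V : Type*} [NormedAddCommGroup V] [InnerProductSpace ℝ V] (b : ℂ)
    (hb : 0 < b.re) (x : V) :
    gaussianSchwartz b hb x = Complex.exp (-b * (‖x‖ ^ 2 : ℝ)) := rfl

/-! ### Reduction to the linear operator -/

theorem bilinearMultiplierOp_quadSumSymbol {n : ℕ} (f g : 𝓢(EuclideanSpace ℝ (Fin n), ℂ)) :
    bilinearMultiplierOp (quadSumSymbol n) f g =
      fun x => linearMultiplierOp (quadSymbol n) f x * linearMultiplierOp (quadSymbol n) g x := by
  ext x
  simp only [bilinearMultiplierOp, linearMultiplierOp]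
  rw [← integral_mul_const]
  congr 1
  ext ξ
  rw [← integral_const_mul]
  congr 1
  ext η
  have h1 : quadSumSymbol n ξ η = quadSymbol n ξ * quadSymbol n η := by
    simp only [quadSumSymbol, quadSymbol, ← Complex.exp_add]
    congr 1
    push_cast
    ring
  have h2 : Complex.exp (2 * Real.pi * Complex.I * (inner ℝ x (ξ + η) : ℝ)) =
      Complex.exp (2 * Real.pi * Complex.I * (inner ℝ x ξ : ℝ)) *
      Complex.exp (2 * Real.pi * Complex.I * (inner ℝ x η : ℝ)) := by
    rw [← Complex.exp_add, inner_add_right]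
    congr 1
    push_cast
    ring
  rw [h1, h2]
  ring

theorem eLpNorm_mul_self {α : Type*} [MeasurableSpace α] (μ : Measure α) (f : α → ℂ) (p : ℝ≥0∞) :
    eLpNorm (fun x => f x * f x) p μ = eLpNorm f (p * 2) μ ^ 2 := by
  have h := eLpNorm_norm_rpow (p := p) (μ := μ) f (q := 2) two_pos
  rw [ENNReal.ofReal_ofNat, ENNReal.rpow_ofNat] at h
  rw [← h]
  refine eLpNorm_congr_norm_ae (Filter.Eventually.of_forall fun x => ?_)
  simp [pow_two]

/-! ### Norms of the focusing Gaussians -/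

theorem eLpNorm_of_norm_eq_gaussian {V : Type*} [NormedAddCommGroup V] [InnerProductSpace ℝ V]
    [FiniteDimensional ℝ V] [MeasurableSpace V] [BorelSpace V] {f : V → ℂ} {A c P : ℝ}
    (hA : 0 ≤ A) (hc : 0 < c) (hP : 0 < P) (hf : ∀ x, ‖f x‖ = A * Real.exp (-c * ‖x‖ ^ 2)) :
    eLpNorm f (ENNReal.ofReal P) volume =
      ENNReal.ofReal (A * (Real.pi / (P * c)) ^ (Module.finrank ℝ V / (2 * P))) := by
  have hcP : 0 < P * c := by positivity
  have hint : ∫ x : V, Real.exp (-(P * c) * ‖x‖ ^ 2) =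
      (Real.pi / (P * c)) ^ (Module.finrank ℝ V / 2 : ℝ) :=
    GaussianFourier.integral_rexp_neg_mul_sq_norm hcP
  -- Were it not integrable, its integral would be the default value `0`, but the closed form is
  -- positive.
  have hi : Integrable fun x : V => Real.exp (-(P * c) * ‖x‖ ^ 2) := by
    by_contra h
    rw [integral_undef h] at hint
    have : 0 < (Real.pi / (P * c)) ^ (Module.finrank ℝ V / 2 : ℝ) := by positivity
    linarith
  rw [eLpNorm_eq_lintegral_rpow_enorm_toReal (by simpa using hP) ENNReal.ofReal_ne_top,
    ENNReal.toReal_ofReal hP.le]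
  have h1 (x : V) : ‖f x‖ₑ ^ P =
      ENNReal.ofReal (A ^ P) * ENNReal.ofReal (Real.exp (-(P * c) * ‖x‖ ^ 2)) := by
    rw [← ofReal_norm, hf, ENNReal.ofReal_rpow_of_nonneg (by positivity) hP.le,
      Real.mul_rpow hA (by positivity), ENNReal.ofReal_mul (by positivity), ← Real.exp_mul]
    congr 3
    ring
  simp_rw [h1]
  rw [lintegral_const_mul' _ _ ENNReal.ofReal_ne_top,
    ← ofReal_integral_eq_lintegral_ofReal hi (Filter.Eventually.of_forall fun x => by positivity),
    hint, ← ENNReal.ofReal_mul (by positivity),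
    ENNReal.ofReal_rpow_of_nonneg (by positivity) (by positivity),
    Real.mul_rpow (by positivity) (by positivity), ← Real.rpow_mul hA, ← Real.rpow_mul
    (by positivity), mul_one_div_cancel hP.ne', Real.rpow_one]
  congr 3
  field_simp

/-- The parameter `π² / (s + i)` of the Gaussian focused by the multiplier `e^{i|ξ|²}`. -/
noncomputable def chirpParam (s : ℝ) : ℂ := Real.pi ^ 2 / (s + Complex.I)

theorem chirpParam_re (s : ℝ) : (chirpParam s).re = Real.pi ^ 2 * s / (s ^ 2 + 1) := by
  have : ((Real.pi : ℂ) ^ 2) = ((Real.pi ^ 2 : ℝ) : ℂ) := by push_cast; rfl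
  rw [chirpParam, this, Complex.div_re, Complex.ofReal_re, Complex.ofReal_im]
  simp [Complex.normSq_apply]
  ring

theorem chirpParam_re_pos {s : ℝ} (hs : 0 < s) : 0 < (chirpParam s).re := by
  rw [chirpParam_re]
  positivity

theorem ofReal_add_I_ne_zero (s : ℝ) : (s : ℂ) + Complex.I ≠ 0 := by
  intro h
  simpa using congrArg Complex.im h

theorem linearMultiplierOp_gaussianSchwartz {n : ℕ} {s : ℝ} (hs : 0 < s)
    (x : EuclideanSpace ℝ (Fin n)) :
    linearMultiplierOp (quadSymbol n) (gaussianSchwartz (chirpParam s) (chirpParam_re_pos hs)) x =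
      (Real.pi / chirpParam s) ^ (n / 2 : ℂ) * ((Real.pi / s) ^ (n / 2 : ℂ) *
        Complex.exp (-(Real.pi ^ 2 / s * ‖x‖ ^ 2 : ℝ))) := by
  have hpi : (Real.pi : ℂ) ≠ 0 := by exact_mod_cast Real.pi_ne_zero
  have hsc : (s : ℂ) ≠ 0 := by exact_mod_cast hs.ne'
  have hsI := ofReal_add_I_ne_zero s
  have hF (ξ : EuclideanSpace ℝ (Fin n)) :
      𝓕 (gaussianSchwartz (chirpParam s) (chirpParam_re_pos hs) :
        EuclideanSpace ℝ (Fin n) → ℂ) ξ =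
      (Real.pi / chirpParam s) ^ (n / 2 : ℂ) * Complex.exp (-(s + Complex.I) * ‖ξ‖ ^ 2) := by
    have h := fourier_gaussian_innerProductSpace (V := EuclideanSpace ℝ (Fin n))
      (chirpParam_re_pos hs) ξ
    rw [finrank_euclideanSpace_fin] at h
    have h2 : (gaussianSchwartz (chirpParam s) (chirpParam_re_pos hs) :
        EuclideanSpace ℝ (Fin n) → ℂ) = fun v => Complex.exp (-chirpParam s * ‖v‖ ^ 2) := by
      ext v
      rw [gaussianSchwartz_apply]
      push_cast
      rfl
    rw [h2, h]
    congr 2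
    rw [chirpParam]
    field_simp
  have hG := GaussianFourier.integral_cexp_neg_mul_sq_norm_add
    (V := EuclideanSpace ℝ (Fin n)) (b := (s : ℂ)) (by simpa using hs)
    (2 * Real.pi * Complex.I) x
  rw [finrank_euclideanSpace_fin] at hG
  rw [linearMultiplierOp]
  have hint (ξ : EuclideanSpace ℝ (Fin n)) :
      𝓕 (gaussianSchwartz (chirpParam s) (chirpParam_re_pos hs) :
        EuclideanSpace ℝ (Fin n) → ℂ) ξ * quadSymbol n ξ *
        Complex.exp (2 * Real.pi * Complex.I * (inner ℝ x ξ : ℝ)) =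
      (Real.pi / chirpParam s) ^ (n / 2 : ℂ) *
        Complex.exp (-s * ‖ξ‖ ^ 2 + 2 * Real.pi * Complex.I * (inner ℝ x ξ : ℝ)) := by
    rw [hF, quadSymbol, mul_assoc, mul_assoc, ← Complex.exp_add, ← Complex.exp_add]
    congr 2
    push_cast
    ring
  simp_rw [hint]
  rw [integral_const_mul, hG]
  congr 3
  push_cast
  field_simp
  rw [Complex.I_sq]
  ring

theorem norm_gaussianSchwartz {V : Type*} [NormedAddCommGroup V] [InnerProductSpace ℝ V] (b : ℂ)
    (hb : 0 < b.re) (x : V) :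
    ‖gaussianSchwartz b hb x‖ = 1 * Real.exp (-b.re * ‖x‖ ^ 2) := by
  rw [gaussianSchwartz_apply, Complex.norm_exp, one_mul, Complex.re_mul_ofReal, Complex.neg_re]

theorem eLpNorm_gaussianSchwartz_chirpParam_le {n : ℕ} {s P : ℝ} (hs : 0 < s) (hs1 : s ≤ 1)
    (hP : 0 < P) :
    eLpNorm (gaussianSchwartz (chirpParam s) (chirpParam_re_pos hs) :
      EuclideanSpace ℝ (Fin n) → ℂ) (ENNReal.ofReal P) volume ≤
      ENNReal.ofReal ((2 / (Real.pi * P)) ^ (n / (2 * P)) * s ^ (-(n / (2 * P)))) := by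
  rw [eLpNorm_of_norm_eq_gaussian zero_le_one (chirpParam_re_pos hs) hP
    (norm_gaussianSchwartz _ _), one_mul, finrank_euclideanSpace_fin, Real.rpow_neg hs.le,
    ← Real.inv_rpow hs.le, ← Real.mul_rpow (by positivity) (by positivity)]
  have h0 := chirpParam_re_pos hs
  gcongr
  rw [chirpParam_re]
  have : Real.pi / (P * (Real.pi ^ 2 * s / (s ^ 2 + 1))) =
      (s ^ 2 + 1) / (Real.pi * P) * s⁻¹ := by
    field_simp
  rw [this]
  gcongr
  -- `s ≤ 1` gives `s² + 1 ≤ 2`, the source of the constant `2`.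
  nlinarith

theorem le_eLpNorm_linearMultiplierOp_gaussianSchwartz {n : ℕ} {s P : ℝ} (hs : 0 < s)
    (hP : 0 < P) :
    ENNReal.ofReal ((1 / (Real.pi * P)) ^ (n / (2 * P)) * s ^ (-(n / 2) + n / (2 * P) : ℝ)) ≤
    eLpNorm (linearMultiplierOp (quadSymbol n)
      (gaussianSchwartz (chirpParam s) (chirpParam_re_pos hs))) (ENNReal.ofReal P) volume := by
  have hsI := ofReal_add_I_ne_zero s
  have hpi : (Real.pi : ℂ) ≠ 0 := by exact_mod_cast Real.pi_ne_zero
  have hq : (Real.pi : ℂ) / chirpParam s = (s + Complex.I) / Real.pi := by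
    rw [chirpParam]
    field_simp
  have hpow (z : ℂ) : ‖z ^ (n / 2 : ℂ)‖ = ‖z‖ ^ (n / 2 : ℝ) := by
    have : (n / 2 : ℂ) = ((n / 2 : ℝ) : ℂ) := by push_cast; rfl
    rw [this, Complex.norm_cpow_real]
  have hps : ((Real.pi : ℂ) / s) = ((Real.pi / s : ℝ) : ℂ) := by push_cast; rfl
  have hps0 : 0 < Real.pi / s := by positivity
  rw [eLpNorm_of_norm_eq_gaussian
    (A := (‖(s : ℂ) + Complex.I‖ / Real.pi) ^ (n / 2 : ℝ) * (Real.pi / s) ^ (n / 2 : ℝ))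
    (c := Real.pi ^ 2 / s) (by positivity) (by positivity) hP]
  · rw [finrank_euclideanSpace_fin]
    -- The amplitude stays of full size `s^{-n/2}` because `|s + i| ≥ 1`.
    have h1 : (1 : ℝ) ≤ ‖(s : ℂ) + Complex.I‖ := by
      simpa using Complex.abs_im_le_norm ((s : ℂ) + Complex.I)
    have h2 : Real.pi / (P * (Real.pi ^ 2 / s)) = 1 / (Real.pi * P) * s := by
      field_simp
    rw [h2, Real.mul_rpow (by positivity) hs.le, Real.rpow_add hs]
    have h3 : s ^ (-(n / 2) : ℝ) ≤
        (‖(s : ℂ) + Complex.I‖ / Real.pi) ^ (n / 2 : ℝ) * (Real.pi / s) ^ (n / 2 : ℝ) := by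
      rw [Real.rpow_neg hs.le, ← Real.inv_rpow hs.le, ← Real.mul_rpow (by positivity)
        (by positivity)]
      gcongr
      have : ‖(s : ℂ) + Complex.I‖ / Real.pi * (Real.pi / s) = ‖(s : ℂ) + Complex.I‖ * s⁻¹ := by
        field_simp
      rw [this]
      exact le_mul_of_one_le_left (by positivity) h1
    refine ENNReal.ofReal_le_ofReal ?_
    calc _ = s ^ (-(n / 2) : ℝ) *
          ((1 / (Real.pi * P)) ^ (n / (2 * P)) * s ^ (n / (2 * P))) := by ring
      _ ≤ _ := by gcongr
  · intro x
    rw [linearMultiplierOp_gaussianSchwartz hs, norm_mul, norm_mul, hq,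
      hpow, hps, hpow, norm_div,
      Complex.norm_real, Complex.norm_real, Real.norm_of_nonneg Real.pi_pos.le,
      Real.norm_of_nonneg hps0.le, mul_assoc, Complex.norm_exp]
    congr 3
    rw [← Complex.ofReal_neg, Complex.ofReal_re]
    ring

/-! ### Blow-up as `s → 0`, and its consequences -/

theorem not_exists_eLpNorm_linearMultiplierOp_sq_le {n : ℕ} (hn : 1 ≤ n) {P Q R : ℝ} (hP : 0 < P)
    (hQ : 0 < Q) (hR : 1 < R) (h : P⁻¹ + Q⁻¹ = R⁻¹) :
    ¬ ∃ C : ℝ≥0, ∀ f : 𝓢(EuclideanSpace ℝ (Fin n), ℂ),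
      eLpNorm (linearMultiplierOp (quadSymbol n) f) (ENNReal.ofReal (R * 2)) volume ^ 2 ≤
        C * eLpNorm f (ENNReal.ofReal P) volume * eLpNorm f (ENNReal.ofReal Q) volume := by
  rintro ⟨C, hC⟩
  have hR0 : 0 < R := by linarith
  set a : ℝ := (1 / (Real.pi * (R * 2))) ^ (n / (2 * (R * 2))) with ha
  set u : ℝ := (2 / (Real.pi * P)) ^ (n / (2 * P)) with hu
  set v : ℝ := (2 / (Real.pi * Q)) ^ (n / (2 * Q)) with hv
  have ha0 : 0 < a := by positivity
  have hu0 : 0 < u := by positivity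
  have hv0 : 0 < v := by positivity
  have hn0 : (0 : ℝ) < n := by exact_mod_cast hn
  have hR1 : R⁻¹ < 1 := inv_lt_one_of_one_lt₀ hR
  have bound (s : ℝ) (hs : 0 < s) (hs1 : s ≤ 1) :
      s ^ (-(n * (1 - R⁻¹))) ≤ C * u * v / a ^ 2 := by
    have h1 := hC (gaussianSchwartz (chirpParam s) (chirpParam_re_pos hs))
    have h2 := le_eLpNorm_linearMultiplierOp_gaussianSchwartz (n := n) hs
      (P := R * 2) (by positivity)
    have h3 := eLpNorm_gaussianSchwartz_chirpParam_le (n := n) hs hs1 hP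
    have h4 := eLpNorm_gaussianSchwartz_chirpParam_le (n := n) hs hs1 hQ
    have h5 := ((pow_le_pow_left' h2 2).trans h1).trans
      (mul_le_mul' (mul_le_mul' le_rfl h3) h4)
    rw [← ha, ← hu, ← hv, ← ENNReal.ofReal_coe_nnreal, ← ENNReal.ofReal_pow (by positivity),
      ← ENNReal.ofReal_mul (by positivity), ← ENNReal.ofReal_mul (by positivity),
      ENNReal.ofReal_le_ofReal_iff (by positivity)] at h5
    -- Exponents: `2(-n/2 + n/(4R)) + n/(2P) + n/(2Q) = -n + n/R`.
    have h6 : s ^ (-(n * (1 - R⁻¹))) = (s ^ (-(n / 2) + n / (2 * (R * 2)) : ℝ)) ^ 2 /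
        (s ^ (-(n / (2 * P))) * s ^ (-(n / (2 * Q)))) := by
      rw [← Real.rpow_natCast, ← Real.rpow_mul hs.le, ← Real.rpow_add hs, ← Real.rpow_sub hs]
      congr 1
      have e1 : (n : ℝ) / (2 * P) = n / 2 * P⁻¹ := by field_simp
      have e2 : (n : ℝ) / (2 * Q) = n / 2 * Q⁻¹ := by field_simp
      have e3 : (n : ℝ) / (2 * (R * 2)) = n / 4 * R⁻¹ := by field_simp; norm_num
      rw [e1, e2, e3, ← h]
      push_cast
      ring
    rw [h6, div_le_div_iff₀ (by positivity) (by positivity)]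
    linarith
  have ht : Filter.Tendsto (fun s : ℝ => s ^ (-(n * (1 - R⁻¹)))) (nhdsWithin 0 (Set.Ioi 0))
      Filter.atTop :=
    tendsto_rpow_neg_nhdsGT_zero (neg_lt_zero.2 (mul_pos hn0 (by linarith)))
  obtain ⟨s, hs, hs2⟩ := ((ht.eventually_gt_atTop (C * u * v / a ^ 2)).and
    (Ioc_mem_nhdsGT (zero_lt_one (α := ℝ)))).exists
  exact absurd (bound s hs2.1 hs2.2) (not_le.2 hs)

theorem isLpMultiplier_of_isBilinearMultiplier {n : ℕ} {p : ℝ≥0∞}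
    (h : IsBilinearMultiplier (quadSumSymbol n) p p (p / 2)) :
    IsLpMultiplier (quadSymbol n) p := by
  obtain ⟨C, hC⟩ := h
  refine ⟨NNReal.sqrt C, fun f => ?_⟩
  have h1 := hC f f
  rw [bilinearMultiplierOp_quadSumSymbol, eLpNorm_mul_self,
    ENNReal.div_mul_cancel (by norm_num) (by norm_num), mul_assoc, ← pow_two] at h1
  have h2 : (C : ℝ≥0∞) = (NNReal.sqrt C : ℝ≥0∞) ^ 2 := by
    rw [← ENNReal.coe_pow, NNReal.sq_sqrt]
  rw [h2, ← mul_pow] at h1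
  exact (ENNReal.pow_le_pow_left_iff two_ne_zero).1 h1

theorem not_isLpMultiplier_quadSymbol {n : ℕ} (hn : 1 ≤ n) {p : ℝ≥0∞} (hp : 2 < p)
    (hp' : p ≠ ∞) : ¬ IsLpMultiplier (quadSymbol n) p := by
  rintro ⟨C, hC⟩
  have h2 : 2 < p.toReal := by
    simpa using (ENNReal.toReal_lt_toReal (by norm_num) hp').2 hp
  refine not_exists_eLpNorm_linearMultiplierOp_sq_le hn (P := p.toReal) (Q := p.toReal)
    (R := p.toReal / 2) (by linarith) (by linarith) (by linarith) (by field_simp; norm_num)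
    ⟨C ^ 2, fun f => ?_⟩
  rw [div_mul_cancel₀ _ two_ne_zero, ENNReal.ofReal_toReal hp']
  calc _ ≤ (C * eLpNorm f p volume) ^ 2 := pow_le_pow_left' (hC f) 2
    _ = _ := by push_cast; ring

theorem bounds_of_mem_localL2Triangle {z : ℝ × ℝ} (hz : z ∈ localL2Triangle) :
    0 ≤ z.1 ∧ 0 ≤ z.2 ∧ z.1 + z.2 ≤ 1 := by
  obtain ⟨p, q, r, ⟨h2p, h2q, ⟨r', hr', -⟩, h⟩, rfl⟩ := hz
  refine ⟨ENNReal.toReal_nonneg, ENNReal.toReal_nonneg, ?_⟩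
  have hr : r⁻¹ ≤ 1 := by
    rw [← hr'.inv_add_inv_eq_one]
    exact le_self_add
  dsimp only at h h2p h2q ⊢
  have hp : p⁻¹ ≠ ∞ := ENNReal.inv_ne_top.2 (by rintro rfl; simp at h2p)
  have hq : q⁻¹ ≠ ∞ := ENNReal.inv_ne_top.2 (by rintro rfl; simp at h2q)
  rw [← ENNReal.toReal_add hp hq, h]
  simpa using ENNReal.toReal_mono ENNReal.one_ne_top hr

theorem bounds_of_mem_interior_localL2Triangle {z : ℝ × ℝ} (hz : z ∈ interior localL2Triangle) :
    0 < z.1 ∧ 0 < z.2 ∧ z.1 + z.2 < 1 := by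
  obtain ⟨ε, hε, hball⟩ := Metric.mem_nhds_iff.1 (mem_interior_iff_mem_nhds.1 hz)
  -- Moving diagonally by `±ε/2` makes all three closed inequalities strict.
  have hmem (d : ℝ) (hd : |d| < ε) : (z.1 + d, z.2 + d) ∈ localL2Triangle := by
    apply hball
    simpa [Prod.dist_eq, Real.dist_eq] using hd
  have h1 := bounds_of_mem_localL2Triangle (hmem (ε / 2) (by rw [abs_of_pos] <;> linarith))
  have h2 := bounds_of_mem_localL2Triangle (hmem (-(ε / 2))
    (by rw [abs_neg, abs_of_pos] <;> linarith))
  dsimp only at h1 h2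
  exact ⟨by linarith [h2.1], by linarith [h2.2.1], by linarith [h1.2.2]⟩

theorem not_isBilinearMultiplier_quadSumSymbol {n : ℕ} (hn : 1 ≤ n) {p q r : ℝ≥0∞}
    (h : p⁻¹ + q⁻¹ = r⁻¹) (hz : (p⁻¹.toReal, q⁻¹.toReal) ∈ interior localL2Triangle) :
    ¬ IsBilinearMultiplier (quadSumSymbol n) p q r := by
  rintro ⟨C, hC⟩
  obtain ⟨hp, hq, hpq⟩ := bounds_of_mem_interior_localL2Triangle hz
  dsimp only at hp hq hpq
  -- A positive `toReal` means neither `0` nor `∞`, so `p` is finite and nonzero.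
  have hp' := ENNReal.toReal_pos_iff.1 hp
  have hq' := ENNReal.toReal_pos_iff.1 hq
  have hsum : p⁻¹.toReal + q⁻¹.toReal = r⁻¹.toReal := by
    rw [← ENNReal.toReal_add hp'.2.ne hq'.2.ne, h]
  have hptop : p ≠ ∞ := ENNReal.inv_ne_zero.1 hp'.1.ne'
  have hqtop : q ≠ ∞ := ENNReal.inv_ne_zero.1 hq'.1.ne'
  have hrtop : r ≠ ∞ := ENNReal.inv_ne_zero.1 (by rw [← h]; simp [hptop])
  rw [ENNReal.toReal_inv] at hp hq hsum hpq
  rw [ENNReal.toReal_inv] at hsum hpq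
  rw [ENNReal.toReal_inv] at hsum
  rw [hsum] at hpq
  have hr0 : 0 < r.toReal⁻¹ := by linarith
  have hr1 : 1 < r.toReal := (inv_lt_one₀ (inv_pos.1 hr0)).1 hpq
  refine not_exists_eLpNorm_linearMultiplierOp_sq_le hn (inv_pos.1 hp) (inv_pos.1 hq) hr1 hsum
    ⟨C, fun f => ?_⟩
  have h1 := hC f f
  rw [bilinearMultiplierOp_quadSumSymbol, eLpNorm_mul_self] at h1
  rwa [ENNReal.ofReal_mul ENNReal.toReal_nonneg, ENNReal.ofReal_toReal hptop,
    ENNReal.ofReal_toReal hqtop, ENNReal.ofReal_toReal hrtop, ENNReal.ofReal_ofNat]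

theorem mainTheorem7 (n : ℕ) (hn : 1 ≤ n) :
    (∀ p q r : ℝ≥0∞, p⁻¹ + q⁻¹ = r⁻¹ →
      (p⁻¹.toReal, q⁻¹.toReal) ∈ interior localL2Triangle →
        ¬ IsBilinearMultiplier (quadSumSymbol n) p q r) ∧
    (∀ p : ℝ≥0∞, 2 < p → p < 4 →
      (IsBilinearMultiplier (quadSumSymbol n) p p (p / 2) → IsLpMultiplier (quadSymbol n) p) ∧
      ¬ IsLpMultiplier (quadSymbol n) p) :=
  ⟨fun _ _ _ h hz => not_isBilinearMultiplier_quadSumSymbol hn h hz, fun _ h2 h4 =>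
    ⟨isLpMultiplier_of_isBilinearMultiplier, not_isLpMultiplier_quadSymbol hn h2 h4.ne_top⟩⟩
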